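/- Equip each unit sphere $S^m=\{x\in\mathbb R^{m+1} : \|x\|=1\}$ with the geodesic metric $d(x,y)=\arccos\langle x,y\rangle$. A (not necessarily continuous) function $f\colon S^k\to S^n$ is odd if $f(-x)=-f(x)$ for all $x$. Its modulus of discontinuity is $$\delta(f)=\inf\{\delta\ge 0 : \text{every } x\in S^k \text{ has an open neighborhood } U_x \text{ with } \operatorname{diam}(f(U_x))\le\delta\},$$ and its distortion is $\operatorname{dis}(f)=\sup_{x,x'\in S^k}|d(x,x')-d(f(x),f(x'))|$. Fix $n\ge 1$. As $k\to\infty$, the modulus of discontinuity and the distortion of odd functions $S^k\to S^n$ both tend to their maximum possible value $\pi$, uniformly over all odd functions. Precisely: (1) For every $k\ge 1$, $\max\{\delta(f)\mid f\colon S^k\to S^n \text{ odd}\}=\pi$ and $\max\{\operatorname{dis}(f)\mid f\colon S^k\to S^n\text{ odd}\}=\pi$. (2) For every $\varepsilon>0$ there is a $K$ such that for all $k\ge K$ and every odd function $f\colon S^k\to S^n$, $$\pi-\varepsilon<\delta(f)\le\pi\quad\text{and}\quad \pi-\varepsilon<\operatorname{dis}(f)\le\pi .$$ -/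

import Mathlib

/-- The unit sphere `S^n` in Euclidean space `ℝ^(n+1)`. This is a separate type, because it carries
the geodesic metric below and not the Euclidean (chordal) one. -/
def GeoSphere (n : ℕ) : Type :=
  {x : EuclideanSpace ℝ (Fin (n + 1)) // ‖x‖ = 1}

namespace GeoSphere

/-- The antipodal involution. -/
instance (n : ℕ) : Neg (GeoSphere n) :=
  ⟨fun x => ⟨-x.1, by rw [norm_neg]; exact x.2⟩⟩

theorem arccos_inner_eq_angle {n : ℕ} (x y : GeoSphere n) :
    Real.arccos (inner ℝ x.1 y.1) = InnerProductGeometry.angle x.1 y.1 := by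
  rw [InnerProductGeometry.angle, x.2, y.2, mul_one, div_one]

/-- The geodesic metric `d(x, y) = arccos ⟨x, y⟩`, in which great circles have length `2π`.
The topology is the one of this metric. -/
noncomputable instance (n : ℕ) : MetricSpace (GeoSphere n) where
  dist x y := Real.arccos (inner ℝ x.1 y.1)
  dist_self x := by
    rw [real_inner_self_eq_norm_sq, x.2, one_pow, Real.arccos_one]
  dist_comm x y := by rw [real_inner_comm]
  dist_triangle x y z := by
    rw [arccos_inner_eq_angle, arccos_inner_eq_angle, arccos_inner_eq_angle]
    exact InnerProductGeometry.angle_le_angle_add_angle _ _ _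
  eq_of_dist_eq_zero := by
    intro x y h
    have h1 : (1 : ℝ) ≤ inner ℝ x.1 y.1 := Real.arccos_eq_zero.mp h
    have h2 : inner ℝ x.1 y.1 ≤ ‖x.1‖ * ‖y.1‖ := real_inner_le_norm _ _
    rw [x.2, y.2, mul_one] at h2
    exact Subtype.ext ((inner_eq_one_iff_of_norm_eq_one x.2 y.2).mp (le_antisymm h2 h1))

theorem dist_def {n : ℕ} (x y : GeoSphere n) :
    dist x y = Real.arccos (inner ℝ x.1 y.1) := rfl

instance (n : ℕ) : BoundedSpace (GeoSphere n) :=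
  ⟨Metric.isBounded_iff.mpr ⟨Real.pi, fun _ _ _ _ => Real.arccos_le_pi _⟩⟩

end GeoSphere

/-- The modulus of discontinuity of a (possibly discontinuous) function into a bounded metric
space: the infimum of all `δ ≥ 0` such that every point has an open neighbourhood whose image has
diameter at most `δ`. -/
noncomputable def modulusOfDiscontinuity {X Y : Type*} [TopologicalSpace X] [MetricSpace Y]
    [BoundedSpace Y] (f : X → Y) : ℝ :=
  sInf {δ : ℝ | 0 ≤ δ ∧ ∀ x : X, ∃ U : Set X, IsOpen U ∧ x ∈ U ∧ Metric.diam (f '' U) ≤ δ}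

/-- The distortion of a (possibly discontinuous) function between bounded metric spaces:
the supremum over all `x, x'` of `|d(x, x') - d(f x, f x')|`. -/
noncomputable def distortion {X Y : Type*} [MetricSpace X] [BoundedSpace X] [MetricSpace Y]
    [BoundedSpace Y] (f : X → Y) : ℝ :=
  sSup {t : ℝ | ∃ x x' : X, t = |dist x x' - dist (f x) (f x')|}

/-! The lower bound is a discontinuous Lyusternik-Shnirelmann argument. If `δ(f)` were at most `π -
ε`, every point of `S^k` would have a neighbourhood whose image has diameter at most `π - ε/2`. A
finite net on `S^n` yields `m` odd functions `s j : S^n → ZMod 2`, with `m` depending only on `n`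
and `ε`, such that any set of diameter at most `π - ε/2` has some `s j` vanishing on it
(`exists_odd_family`). The functions `s j ∘ f` are odd on `S^k`; if `k ≥ m`, some finite set inside
one of the neighbourhoods makes all of them nonconstant (`exists_small_list`), a contradiction.

The last claim needs no continuity. The coboundary of an odd function `s j` is invariant under the
antipode and plays the part of the generator of `H^1(RP^k; ZMod 2)`. If chains `g i` satisfy `∂ g 0
= []` and `∂ g (i+1) = g i + ν (g i)`, then the cup product of `m` such coboundaries takes the value
1 on `g m` (`eval_cup_eq_one`), so some tuple of `g m` sees every `s j` change. Chains `g i` with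
arbitrarily small tuples come from equivariant barycentric subdivision of the cross-polytope,
followed by radial projection.

The bound passes to the distortion because `δ(f) ≤ dis(f)`. The value `π` is attained by an odd map
onto two antipodal points that jumps across an equator. -/

/-- Mod 2 chains on ordered tuples of elements of `V`. The empty tuple makes the complex
augmented. -/
abbrev TupleChain (V : Type*) := List V →₀ ZMod 2

/-! ### Augmented mod 2 chains: cones, boundary and subdivision. -/

namespace TupleChain

variable {V W : Type*}

/-- Two mod 2 chains cancel. -/
theorem add_self (c : TupleChain V) : c + c = 0 := by
  ext σ
  simp [CharTwo.add_self_eq_zero]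

/-- The cone with apex `x`. -/
noncomputable def cone (x : V) : TupleChain V →ₗ[ZMod 2] TupleChain V :=
  Finsupp.lmapDomain _ _ (List.cons x)

@[simp] theorem cone_single (x : V) (σ : List V) (a : ZMod 2) :
    cone x (Finsupp.single σ a) = Finsupp.single (x :: σ) a :=
  Finsupp.mapDomain_single

/-- The boundary of a single tuple. -/
noncomputable def bdryList : List V → TupleChain V
  | [] => 0
  | x :: l => Finsupp.single l 1 + cone x (bdryList l)

/-- The boundary operator. -/
noncomputable def bdry : TupleChain V →ₗ[ZMod 2] TupleChain V :=
  Finsupp.linearCombination _ bdryList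

@[simp] theorem bdry_single (σ : List V) : bdry (Finsupp.single σ 1) = bdryList σ := by
  simp [bdry]

theorem linearMap_ext {M : Type*} [AddCommMonoid M] [Module (ZMod 2) M]
    {f g : TupleChain V →ₗ[ZMod 2] M}
    (h : ∀ σ, f (Finsupp.single σ 1) = g (Finsupp.single σ 1)) (c : TupleChain V) :
    f c = g c := by
  have : f = g := by
    refine Finsupp.lhom_ext' fun σ => LinearMap.ext_ring ?_
    simpa using h σ
  rw [this]

theorem bdry_cone (x : V) (c : TupleChain V) : bdry (cone x c) = c + cone x (bdry c) :=
  linearMap_ext (f := bdry ∘ₗ cone x) (g := LinearMap.id + cone x ∘ₗ bdry)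
    (fun σ => by simp [bdryList]) c

theorem bdry_bdryList (σ : List V) : bdry (bdryList σ) = 0 := by
  induction σ with
  | nil => simp [bdryList]
  | cons x l ih =>
    rw [bdryList, map_add, bdry_single, bdry_cone, ih, map_zero, add_zero, add_self]

/-- The chain map induced by a map of vertices. -/
noncomputable def map (g : V → W) : TupleChain V →ₗ[ZMod 2] TupleChain W :=
  Finsupp.lmapDomain _ _ (List.map g)

@[simp] theorem map_single (g : V → W) (σ : List V) (a : ZMod 2) :
    map g (Finsupp.single σ a) = Finsupp.single (σ.map g) a :=
  Finsupp.mapDomain_single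

theorem map_cone (g : V → W) (x : V) (c : TupleChain V) :
    map g (cone x c) = cone (g x) (map g c) :=
  linearMap_ext (f := map g ∘ₗ cone x) (g := cone (g x) ∘ₗ map g) (fun σ => by simp) c

theorem map_bdryList (g : V → W) (σ : List V) : map g (bdryList σ) = bdryList (σ.map g) := by
  induction σ with
  | nil => simp [bdryList]
  | cons x l ih => simp [bdryList, map_cone, ih]

theorem bdry_map (g : V → W) (c : TupleChain V) : bdry (map g c) = map g (bdry c) :=
  linearMap_ext (f := bdry ∘ₗ map g) (g := map g ∘ₗ bdry)
    (fun σ => by simp [map_bdryList]) c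

theorem map_map_self {g : V → V} (hg : Function.Involutive g) (c : TupleChain V) :
    map g (map g c) = c :=
  linearMap_ext (f := map g ∘ₗ map g) (g := LinearMap.id)
    (fun σ => by simp [hg.comp_self]) c

/-- The subdivision operator on tuples of length `n`, where `b` picks the apex of each tuple. -/
noncomputable def sd (b : List V → V) : ℕ → TupleChain V →ₗ[ZMod 2] TupleChain V
  | 0 => LinearMap.id
  | n + 1 => Finsupp.linearCombination _ fun σ => cone (b σ) (sd b n (bdryList σ))

theorem sd_succ_single (b : List V → V) (n : ℕ) (σ : List V) :
    sd b (n + 1) (Finsupp.single σ 1) = cone (b σ) (sd b n (bdryList σ)) := by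
  simp [sd]

/-- The cone formula leaves the subdivided boundary plus a cone on a term that dies by `∂∂ = 0`. The
index of `sd` is the tuple length, hence drops by one. -/
theorem bdry_sd (b : List V → V) (n : ℕ) (c : TupleChain V) :
    bdry (sd b (n + 1) c) = sd b n (bdry c) := by
  induction n generalizing c with
  | zero =>
    refine linearMap_ext (f := bdry ∘ₗ sd b 1) (g := sd b 0 ∘ₗ bdry) (fun σ => ?_) c
    simp [sd, bdry_cone, bdry_bdryList]
  | succ n ih =>
    refine linearMap_ext (f := bdry ∘ₗ sd b (n + 2)) (g := sd b (n + 1) ∘ₗ bdry) (fun σ => ?_) c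
    simp only [LinearMap.comp_apply, sd_succ_single, bdry_cone, ih, bdry_bdryList, map_zero,
      add_zero, bdry_single]

theorem map_sd {g : V → V} {b : List V → V} (hb : ∀ σ, b (σ.map g) = g (b σ)) (n : ℕ)
    (c : TupleChain V) : map g (sd b n c) = sd b n (map g c) := by
  induction n generalizing c with
  | zero => rfl
  | succ n ih =>
    refine linearMap_ext (f := map g ∘ₗ sd b (n + 1)) (g := sd b (n + 1) ∘ₗ map g)
      (fun σ => ?_) c
    simp only [LinearMap.comp_apply, sd_succ_single, map_cone, ih, map_bdryList, map_single, hb]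

/-! ### Cup products of coboundaries of odd functions. -/

/-- The pairing of a chain with a cochain. -/
noncomputable def eval (φ : List V → ZMod 2) : TupleChain V →ₗ[ZMod 2] ZMod 2 :=
  Finsupp.linearCombination _ φ

@[simp] theorem eval_single (φ : List V → ZMod 2) (σ : List V) :
    eval φ (Finsupp.single σ 1) = φ σ := by
  simp [eval]

theorem eval_map (φ : List W → ZMod 2) (g : V → W) (c : TupleChain V) :
    eval φ (map g c) = eval (fun σ => φ (σ.map g)) c :=
  linearMap_ext (f := eval φ ∘ₗ map g) (fun σ => by simp) c

/-- The cup product of the coboundaries of `s (n - 1), …, s 0`. -/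
def cup (s : ℕ → V → ZMod 2) : ℕ → List V → ZMod 2
  | 0, [_] => 1
  | n + 1, x :: y :: l => (s n x + s n y) * cup s n (y :: l)
  | _, _ => 0

/-- The cup product of `s n` and the coboundaries of `s (n - 1), …, s 0`. -/
def halfCup (s : ℕ → V → ZMod 2) (n : ℕ) : List V → ZMod 2
  | [] => 0
  | x :: l => s n x * cup s n (x :: l)

theorem cup_nil (s : ℕ → V → ZMod 2) (n : ℕ) : cup s n [] = 0 := by
  cases n <;> rfl

theorem eval_cup_zero_cone_cone (s : ℕ → V → ZMod 2) (x y : V) (c : TupleChain V) :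
    eval (cup s 0) (cone x (cone y c)) = 0 :=
  linearMap_ext (f := eval (cup s 0) ∘ₗ cone x ∘ₗ cone y) (g := 0)
    (fun σ => by simp [cup]) c

theorem eval_cup_succ_cone_cone (s : ℕ → V → ZMod 2) (n : ℕ) (x y : V) (c : TupleChain V) :
    eval (cup s (n + 1)) (cone x (cone y c)) =
      (s n x + s n y) * eval (cup s n) (cone y c) :=
  linearMap_ext (f := eval (cup s (n + 1)) ∘ₗ cone x ∘ₗ cone y)
    (g := (s n x + s n y) • (eval (cup s n) ∘ₗ cone y)) (fun σ => by simp [cup]) c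

theorem eval_halfCup_cone (s : ℕ → V → ZMod 2) (n : ℕ) (x : V) (c : TupleChain V) :
    eval (halfCup s n) (cone x c) = s n x * eval (cup s n) (cone x c) :=
  linearMap_ext (f := eval (halfCup s n) ∘ₗ cone x)
    (g := s n x • (eval (cup s n) ∘ₗ cone x)) (fun σ => by simp [halfCup]) c

/-- A cup product of coboundaries is a cocycle; the Leibniz rule is unwound on the first three
vertices. -/
theorem eval_cup_bdryList (s : ℕ → V → ZMod 2) (n : ℕ) (σ : List V) :
    eval (cup s n) (bdryList σ) = 0 := by
  induction n generalizing σ with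
  | zero =>
    match σ with
    | [] => simp [bdryList]
    | [x] => simp [bdryList, cup]
    | [x, y] => simp [bdryList, cup, CharTwo.add_self_eq_zero]
    | x :: y :: z :: l =>
      simp only [bdryList, map_add, eval_cup_zero_cone_cone, cone_single, eval_single]
      simp [cup]
  | succ n ih =>
    match σ with
    | [] => simp [bdryList]
    | [x] => simp [bdryList, cup]
    | [x, y] => simp [bdryList, cup]
    | x :: y :: z :: l =>
      have h := ih (y :: z :: l)
      rw [bdryList, map_add, eval_single] at h
      rw [bdryList, map_add, eval_single, bdryList, map_add, map_add, cone_single, eval_single,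
        eval_cup_succ_cone_cone, cup, cup]
      have h' := CharTwo.add_eq_zero.mp h
      rw [← h']
      have h2 : (2 : ZMod 2) = 0 := rfl
      linear_combination (s n y * cup s n (z :: l) + s n z * cup s n (z :: l) +
        s n x * cup s n (z :: l)) * h2

/-- The Leibniz rule `d(s ∪ c) = ds ∪ c` for the cocycle `c = cup s n`. -/
theorem eval_halfCup_bdry (s : ℕ → V → ZMod 2) (n : ℕ) (c : TupleChain V) :
    eval (halfCup s n) (bdry c) = eval (cup s (n + 1)) c := by
  refine linearMap_ext (f := eval (halfCup s n) ∘ₗ bdry) (fun σ => ?_) c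
  rw [LinearMap.comp_apply, bdry_single, eval_single]
  match σ with
  | [] => simp [bdryList, cup]
  | [x] => simp [bdryList, cup, halfCup]
  | x :: y :: l =>
    have h := eval_cup_bdryList s n (x :: y :: l)
    rw [bdryList, map_add, eval_single] at h
    have h' := CharTwo.add_eq_zero.mp h
    rw [bdryList, map_add, eval_single, eval_halfCup_cone, ← h', halfCup, cup]
    ring

/-- Both sides count the one-element tuples: `cup s 0` is the augmentation. -/
theorem eval_cup_zero (s : ℕ → V → ZMod 2) (c : TupleChain V) :
    eval (cup s 0) c = bdry c [] := by
  have hc : ∀ (x : V) (c : TupleChain V), cone x c [] = 0 := fun x c =>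
    Finsupp.mapDomain_of_notMem_range _ _ (by simp)
  refine linearMap_ext (f := eval (cup s 0)) (g := Finsupp.lapply [] ∘ₗ bdry) (fun σ => ?_) c
  match σ with
  | [] => simp [bdryList, cup]
  | [x] => simp [bdryList, cup]
  | x :: y :: l => simp [bdryList, cup, hc]

theorem cup_map {ν : V → V} {s : ℕ → V → ZMod 2} (hs : ∀ j x, s j (ν x) = s j x + 1) (n : ℕ)
    (σ : List V) : cup s n (σ.map ν) = cup s n σ := by
  induction n generalizing σ with
  | zero => rcases σ with _ | ⟨x, _ | ⟨y, l⟩⟩ <;> rfl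
  | succ n ih =>
    rcases σ with _ | ⟨x, _ | ⟨y, l⟩⟩
    · rfl
    · rfl
    · have h := ih (y :: l)
      simp only [List.map_cons] at h ⊢
      rw [cup, cup, h, hs, hs]
      have h2 : (2 : ZMod 2) = 0 := rfl
      linear_combination cup s n (y :: l) * h2

theorem halfCup_map {ν : V → V} {s : ℕ → V → ZMod 2} (hs : ∀ j x, s j (ν x) = s j x + 1) (n : ℕ)
    (σ : List V) : halfCup s n (σ.map ν) = halfCup s n σ + cup s n σ := by
  rcases σ with _ | ⟨x, l⟩
  · simp [halfCup, cup_nil]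
  · have h := cup_map hs n (x :: l)
    simp only [List.map_cons] at h ⊢
    rw [halfCup, halfCup, h, hs]
    ring

/-- The combinatorial core of the Borsuk-Ulam theorem. -/
theorem eval_cup_eq_one {ν : V → V} {s : ℕ → V → ZMod 2} (hs : ∀ j x, s j (ν x) = s j x + 1)
    {g : ℕ → TupleChain V} (h0 : bdry (g 0) = Finsupp.single [] 1) {m : ℕ}
    (hg : ∀ i < m, bdry (g (i + 1)) = g i + map ν (g i)) :
    eval (cup s m) (g m) = 1 := by
  induction m with
  | zero => simp [eval_cup_zero, h0]
  | succ m ih =>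
    have h1 := ih fun i hi => hg i (by omega)
    -- On `g m + ν (g m)` the two values of `halfCup` differ exactly by `cup s m`, which is 1 on `g
    -- m` by induction.
    rw [← eval_halfCup_bdry, hg m (by omega), map_add, eval_map]
    have h2 : eval (fun σ => halfCup s m (σ.map ν)) (g m) =
        eval (halfCup s m) (g m) + eval (cup s m) (g m) :=
      linearMap_ext (f := eval fun σ => halfCup s m (σ.map ν))
        (g := eval (halfCup s m) + eval (cup s m))
        (fun σ => by simp [halfCup_map hs]) (g m)
    rw [h2, h1, ← add_assoc, CharTwo.add_self_eq_zero, zero_add]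

/-- The value of `cup` is a product with one factor `s j x + s j y` for each `j < n`, where `x, y`
are consecutive vertices. -/
theorem exists_ne_of_cup_ne_zero {s : ℕ → V → ZMod 2} {n : ℕ} {σ : List V}
    (h : cup s n σ ≠ 0) {j : ℕ} (hj : j < n) : ∃ x ∈ σ, ∃ y ∈ σ, s j x ≠ s j y := by
  induction n generalizing σ with
  | zero => omega
  | succ n ih =>
    rcases σ with _ | ⟨x, _ | ⟨y, l⟩⟩
    · exact absurd rfl h
    · exact absurd rfl h
    · rw [cup] at h
      rcases Nat.lt_succ_iff_lt_or_eq.mp hj with hj | rfl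
      · obtain ⟨u, hu, v, hv, huv⟩ := ih (right_ne_zero_of_mul h) hj
        exact ⟨u, List.mem_cons_of_mem _ hu, v, List.mem_cons_of_mem _ hv, huv⟩
      · refine ⟨x, by simp, y, by simp, fun hxy => left_ne_zero_of_mul h ?_⟩
        rw [hxy, CharTwo.add_self_eq_zero]

theorem exists_mem_support_of_eval_ne_zero {φ : List V → ZMod 2} {c : TupleChain V}
    (h : eval φ c ≠ 0) : ∃ σ ∈ c.support, φ σ ≠ 0 := by
  by_contra! hc
  refine h ?_
  rw [eval, Finsupp.linearCombination_apply]
  exact Finset.sum_eq_zero fun σ hσ => by simp [hc σ hσ]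

/-! ### Supports of chains. -/

theorem linearCombination_mem {M : Type*} [AddCommGroup M] [Module (ZMod 2) M]
    {N : Submodule (ZMod 2) M} {f : List V → M} {S : Set (List V)} (hf : ∀ σ ∈ S, f σ ∈ N)
    {c : TupleChain V} (hc : c ∈ Finsupp.supported (ZMod 2) (ZMod 2) S) :
    Finsupp.linearCombination (ZMod 2) f c ∈ N := by
  rw [Finsupp.linearCombination_apply]
  exact N.sum_mem fun σ hσ => N.smul_mem _ (hf σ (hc hσ))

theorem cone_mem_supported {x : V} {S T : Set (List V)} (h : ∀ σ ∈ S, x :: σ ∈ T)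
    {c : TupleChain V} (hc : c ∈ Finsupp.supported (ZMod 2) (ZMod 2) S) :
    cone x c ∈ Finsupp.supported (ZMod 2) (ZMod 2) T := by
  classical
  intro τ hτ
  obtain ⟨σ, hσ, rfl⟩ := Finset.mem_image.mp (Finsupp.mapDomain_support hτ)
  exact h σ (hc hσ)

theorem map_mem_supported {g : V → W} {S : Set (List V)} {T : Set (List W)}
    (h : ∀ σ ∈ S, σ.map g ∈ T) {c : TupleChain V}
    (hc : c ∈ Finsupp.supported (ZMod 2) (ZMod 2) S) :
    map g c ∈ Finsupp.supported (ZMod 2) (ZMod 2) T := by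
  classical
  intro τ hτ
  obtain ⟨σ, hσ, rfl⟩ := Finset.mem_image.mp (Finsupp.mapDomain_support hτ)
  exact h σ (hc hσ)

theorem bdryList_mem_supported (n : ℕ) (σ : List V) (hσ : σ.length = n + 1) :
    bdryList σ ∈ Finsupp.supported (ZMod 2) (ZMod 2) {τ : List V | τ.length = n ∧ τ ⊆ σ} := by
  induction n generalizing σ with
  | zero =>
    obtain ⟨x, rfl⟩ := List.length_eq_one_iff.mp hσ
    simpa [bdryList] using Finsupp.single_mem_supported (ZMod 2) (1 : ZMod 2)
      (s := {τ : List V | τ = [] ∧ τ ⊆ [x]}) (a := []) (by simp)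
  | succ n ih =>
    rcases σ with _ | ⟨x, l⟩
    · simp at hσ
    · have hl : l.length = n + 1 := by simpa using hσ
      refine Submodule.add_mem _ ?_ (cone_mem_supported ?_ (ih l hl))
      · exact Finsupp.single_mem_supported _ _ ⟨hl, List.subset_cons_self _ _⟩
      · rintro τ ⟨h1, h2⟩
        exact ⟨by simp [h1], List.cons_subset_cons _ h2⟩

theorem bdry_iterate_sd (b : List V → V) (n N : ℕ) (c : TupleChain V) :
    bdry ((sd b (n + 1))^[N] c) = (sd b n)^[N] (bdry c) :=
  Function.Semiconj.iterate_right (f := bdry) (fun c => bdry_sd b n c) N c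

theorem map_iterate_sd {g : V → V} {b : List V → V}
    (hb : ∀ σ, b (σ.map g) = g (b σ)) (n N : ℕ) (c : TupleChain V) :
    map g ((sd b n)^[N] c) = (sd b n)^[N] (map g c) :=
  Function.Semiconj.iterate_right (f := map g) (fun c => map_sd hb n c) N c

/-! ### Mesh of the barycentric subdivision. -/

section Subdivision

variable {E : Type*} [NormedAddCommGroup E] [NormedSpace ℝ E]

/-- The barycentre of a tuple. -/
noncomputable def barycenter (σ : List E) : E := (σ.length : ℝ)⁻¹ • σ.sum

theorem barycenter_map_neg (σ : List E) : barycenter (σ.map Neg.neg) = -barycenter σ := by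
  have h : (σ.map Neg.neg).sum = -σ.sum := by
    induction σ with
    | nil => simp
    | cons x l ih => simp only [List.map_cons, List.sum_cons, ih, neg_add]
  rw [barycenter, barycenter, h, List.length_map, smul_neg]

theorem barycenter_mem {A : Set E} (hA : Convex ℝ A) {σ : List E} (h0 : 0 < σ.length)
    (hσ : ∀ x ∈ σ, x ∈ A) : barycenter σ ∈ A := by
  have h : barycenter σ = ∑ i : Fin σ.length, (σ.length : ℝ)⁻¹ • σ[i] := by
    rw [barycenter, ← Finset.smul_sum]
    exact congrArg _ (Fin.sum_univ_getElem σ).symm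
  rw [h]
  refine hA.sum_mem (fun _ _ => by positivity) ?_ fun i _ => hσ _ (List.getElem_mem _)
  have : (σ.length : ℝ) ≠ 0 := by positivity
  simp [this]

theorem norm_sum_sub_le {D : ℝ} {x : E} {l : List E} (hl : ∀ y ∈ l, dist y x ≤ D) :
    ‖l.sum - (l.length : ℝ) • x‖ ≤ l.length * D := by
  induction l with
  | nil => simp
  | cons y l ih =>
    have h1 := ih fun z hz => hl z (List.mem_cons_of_mem _ hz)
    have h2 := hl y List.mem_cons_self
    rw [dist_eq_norm] at h2
    have h3 : (y :: l).sum - ((y :: l).length : ℝ) • x =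
        (y - x) + (l.sum - (l.length : ℝ) • x) := by
      simp only [List.sum_cons, List.length_cons, Nat.cast_add, Nat.cast_one, add_smul, one_smul]
      abel
    rw [h3, List.length_cons]
    push_cast
    linarith [norm_add_le (y - x) (l.sum - (l.length : ℝ) • x)]

/-- The vertex `x` itself contributes nothing. This saves one `D` and makes the mesh factor less
than 1. -/
theorem norm_sum_sub_le_of_mem {D : ℝ} {x : E} {l : List E} (hl : ∀ y ∈ l, dist y x ≤ D)
    (hx : x ∈ l) : ‖l.sum - (l.length : ℝ) • x‖ ≤ (l.length - 1) * D := by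
  induction l with
  | nil => simp at hx
  | cons y l ih =>
    have h3 : (y :: l).sum - ((y :: l).length : ℝ) • x =
        (y - x) + (l.sum - (l.length : ℝ) • x) := by
      simp only [List.sum_cons, List.length_cons, Nat.cast_add, Nat.cast_one, add_smul, one_smul]
      abel
    have hl' : ∀ z ∈ l, dist z x ≤ D := fun z hz => hl z (List.mem_cons_of_mem _ hz)
    rw [h3, List.length_cons]
    push_cast
    rcases List.mem_cons.mp hx with rfl | hx
    · rw [sub_self, zero_add, add_sub_cancel_right]
      exact norm_sum_sub_le hl'
    · have h2 := hl y List.mem_cons_self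
      rw [dist_eq_norm] at h2
      linarith [norm_add_le (y - x) (l.sum - (l.length : ℝ) • x), ih hl' hx]

theorem dist_barycenter_le {D : ℝ} {x : E} {σ : List E} (hσ : ∀ y ∈ σ, dist y x ≤ D)
    (hx : x ∈ σ) (hD : 0 ≤ D) {M : ℕ} (hM : σ.length ≤ M + 1) :
    dist x (barycenter σ) ≤ M / (M + 1) * D := by
  have h0 : (0 : ℝ) < σ.length := by exact_mod_cast List.length_pos_of_mem hx
  have h1 : barycenter σ - x = (σ.length : ℝ)⁻¹ • (σ.sum - (σ.length : ℝ) • x) := by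
    rw [smul_sub, smul_smul, inv_mul_cancel₀ h0.ne', one_smul, barycenter]
  have h2 := norm_sum_sub_le_of_mem hσ hx
  have hM' : (σ.length : ℝ) ≤ M + 1 := by exact_mod_cast hM
  rw [dist_comm, dist_eq_norm, h1, norm_smul, norm_inv, Real.norm_of_nonneg h0.le]
  calc (σ.length : ℝ)⁻¹ * ‖σ.sum - (σ.length : ℝ) • x‖
      ≤ (σ.length : ℝ)⁻¹ * ((σ.length - 1) * D) := by gcongr
    _ = ((σ.length - 1) / σ.length) * D := by ring
    _ ≤ M / (M + 1) * D := by
      refine mul_le_mul_of_nonneg_right ?_ hD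
      rw [div_le_div_iff₀ h0 (by positivity)]
      linarith

/-- The tuples of length `n` in `A` with pairwise distances at most `D`. -/
def boundedTuples (A : Set E) (n : ℕ) (D : ℝ) : Set (List E) :=
  {τ | τ.length = n ∧ (∀ x ∈ τ, x ∈ A) ∧ ∀ x ∈ τ, ∀ y ∈ τ, dist x y ≤ D}

/-- Each new tuple is the barycentre followed by a tuple from the subdivision of a face. The face is
handled by induction; a ball about the barycentre contains the vertices, hence their hull. -/
theorem sd_single_mem {M : ℕ} {D : ℝ} (hD : 0 ≤ D) {n : ℕ} (hn : n ≤ M + 1) {σ : List E}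
    (hl : σ.length = n) (hσ : ∀ x ∈ σ, ∀ y ∈ σ, dist x y ≤ D) :
    sd barycenter n (Finsupp.single σ 1) ∈ Finsupp.supported (ZMod 2) (ZMod 2)
      (boundedTuples (convexHull ℝ {x | x ∈ σ}) n (M / (M + 1) * D)) := by
  induction n generalizing σ with
  | zero =>
    rw [List.length_eq_zero_iff.mp hl]
    exact Finsupp.single_mem_supported _ _ ⟨rfl, by simp, by simp⟩
  | succ n ih =>
    rw [sd_succ_single]
    have hmem : ∀ x ∈ σ, x ∈ convexHull ℝ {x | x ∈ σ} := fun x hx => subset_convexHull _ _ hx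
    have hb : barycenter σ ∈ convexHull ℝ {x | x ∈ σ} :=
      barycenter_mem (convex_convexHull _ _) (by omega) hmem
    have hdist : ∀ y ∈ convexHull ℝ {x | x ∈ σ},
        dist y (barycenter σ) ≤ M / (M + 1) * D := fun y hy =>
      convexHull_min (t := Metric.closedBall (barycenter σ) (M / (M + 1) * D))
        (fun x hx => dist_barycenter_le (fun z hz => hσ z hz x hx) hx hD (by omega))
        (convex_closedBall _ _) hy
    have hpos : (0 : ℝ) ≤ M / (M + 1) * D := by positivity
    refine cone_mem_supported (S := boundedTuples (convexHull ℝ {x | x ∈ σ}) n (M / (M + 1) * D))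
      ?_ ?_
    · rintro τ ⟨h1, h2, h3⟩
      refine ⟨by simp [h1], ?_, ?_⟩
      · intro x hx
        rcases List.mem_cons.mp hx with rfl | hx
        exacts [hb, h2 x hx]
      · intro x hx y hy
        rcases List.mem_cons.mp hx with rfl | hx <;> rcases List.mem_cons.mp hy with rfl | hy
        · rwa [dist_self]
        · rw [dist_comm]
          exact hdist y (h2 y hy)
        · exact hdist x (h2 x hx)
        · exact h3 x hx y hy
    · have h := linearCombination_mem (f := fun τ => sd barycenter n (Finsupp.single τ 1))
        (N := Finsupp.supported (ZMod 2) (ZMod 2)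
          (boundedTuples (convexHull ℝ {x | x ∈ σ}) n (M / (M + 1) * D))) ?_
        (bdryList_mem_supported n σ hl)
      · rwa [linearMap_ext (g := sd barycenter n) (fun τ => by simp)] at h
      · rintro τ ⟨h1, h2⟩
        refine Finsupp.supported_mono ?_
          (ih (by omega) h1 fun x hx y hy => hσ x (h2 hx) y (h2 hy))
        rintro ρ ⟨h3, h4, h5⟩
        exact ⟨h3, fun x hx => convexHull_mono (fun y hy => h2 hy) (h4 x hx), h5⟩

/-- A family of convex sets is used because the faces of the cross-polytope are convex while their
union is not. -/
theorem sd_mem {M : ℕ} {D : ℝ} (hD : 0 ≤ D) {n : ℕ} (hn : n ≤ M + 1) {ι : Sort*}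
    {A : ι → Set E} (hA : ∀ i, Convex ℝ (A i)) {c : TupleChain E}
    (hc : c ∈ Finsupp.supported (ZMod 2) (ZMod 2) (⋃ i, boundedTuples (A i) n D)) :
    sd barycenter n c ∈ Finsupp.supported (ZMod 2) (ZMod 2)
      (⋃ i, boundedTuples (A i) n (M / (M + 1) * D)) := by
  have h := linearCombination_mem (f := fun τ => sd barycenter n (Finsupp.single τ 1))
    (N := Finsupp.supported (ZMod 2) (ZMod 2)
      (⋃ i, boundedTuples (A i) n (M / (M + 1) * D))) ?_ hc
  · rwa [linearMap_ext (g := sd barycenter n) (fun τ => by simp)] at h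
  · intro τ hτ
    obtain ⟨i, h1, h2, h3⟩ := Set.mem_iUnion.mp hτ
    refine Finsupp.supported_mono ?_ (sd_single_mem hD hn h1 h3)
    rintro ρ ⟨h4, h5, h6⟩
    exact Set.mem_iUnion.mpr ⟨i, h4, fun x hx => convexHull_min h2 (hA i) (h5 x hx), h6⟩

theorem iterate_sd_mem {M : ℕ} {D : ℝ} (hD : 0 ≤ D) {n : ℕ} (hn : n ≤ M + 1) {ι : Sort*}
    {A : ι → Set E} (hA : ∀ i, Convex ℝ (A i)) {c : TupleChain E}
    (hc : c ∈ Finsupp.supported (ZMod 2) (ZMod 2) (⋃ i, boundedTuples (A i) n D)) (N : ℕ) :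
    (sd barycenter n)^[N] c ∈ Finsupp.supported (ZMod 2) (ZMod 2)
      (⋃ i, boundedTuples (A i) n ((M / (M + 1)) ^ N * D)) := by
  induction N with
  | zero => simpa using hc
  | succ N ih =>
    rw [Function.iterate_succ_apply', pow_succ', mul_assoc]
    exact sd_mem (by positivity) hn hA ih

end Subdivision

/-! ### The boundary of the cross-polytope as a chain. -/

section CrossPolytope

variable {E : Type*} [AddCommGroup E]

/-- Half of the boundary sphere of the cross-polytope spanned by `e 0, …, e i`. -/
noncomputable def hemisphere (e : ℕ → E) : ℕ → TupleChain E
  | 0 => Finsupp.single [e 0] 1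
  | i + 1 => cone (e (i + 1)) (hemisphere e i + map Neg.neg (hemisphere e i))

theorem bdry_hemisphere_zero (e : ℕ → E) : bdry (hemisphere e 0) = Finsupp.single [] 1 := by
  simp [hemisphere, bdryList]

theorem bdry_hemisphere_succ (e : ℕ → E) (i : ℕ) :
    bdry (hemisphere e (i + 1)) = hemisphere e i + map Neg.neg (hemisphere e i) := by
  have h : bdry (hemisphere e i + map Neg.neg (hemisphere e i)) = 0 := by
    induction i with
    | zero => simp [bdry_hemisphere_zero, bdry_map, add_self]
    | succ i ih =>
      have h : bdry (hemisphere e (i + 1)) = hemisphere e i + map Neg.neg (hemisphere e i) := by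
        rw [hemisphere, bdry_cone, ih, map_zero, add_zero]
      rw [map_add, bdry_map, h, map_add, map_map_self neg_involutive,
        add_comm (map Neg.neg (hemisphere e i)), add_self]
  rw [hemisphere, bdry_cone, h, map_zero, add_zero]

/-- A single sign vector serves a whole tuple, so that all its vertices lie on one face of the
cross-polytope. -/
theorem hemisphere_mem [Module ℝ E] (e : ℕ → E) (i : ℕ) :
    hemisphere e i ∈ Finsupp.supported (ZMod 2) (ZMod 2)
      {σ : List E | σ.length = i + 1 ∧ ∃ s : ℕ → ℝ, (∀ j, s j = 1 ∨ s j = -1) ∧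
        ∀ x ∈ σ, ∃ j ≤ i, x = s j • e j} := by
  induction i with
  | zero =>
    exact Finsupp.single_mem_supported _ _ ⟨rfl, 1, by simp, by simp⟩
  | succ i ih =>
    refine cone_mem_supported (fun σ hσ => ?_)
      (Submodule.add_mem _ ih (map_mem_supported (fun σ hσ => ?_) ih))
    · obtain ⟨h1, s, h2, h3⟩ := hσ
      refine ⟨by simp [h1], Function.update s (i + 1) 1, fun j => ?_, fun x hx => ?_⟩
      · by_cases hj : j = i + 1
        · simp [hj]
        · simpa [hj] using h2 j
      · rcases List.mem_cons.mp hx with rfl | hx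
        · exact ⟨i + 1, le_rfl, by simp⟩
        · obtain ⟨j, hj, rfl⟩ := h3 x hx
          exact ⟨j, by omega, by rw [Function.update_of_ne (by omega)]⟩
    · obtain ⟨h1, s, h2, h3⟩ := hσ
      refine ⟨by simp [h1], -s, fun j => ?_, fun x hx => ?_⟩
      · rcases h2 j with h | h <;> simp [h]
      · obtain ⟨y, hy, rfl⟩ := List.mem_map.mp hx
        obtain ⟨j, hj, rfl⟩ := h3 y hy
        exact ⟨j, hj, by simp⟩

end CrossPolytope

end TupleChain

/-! ### The geodesic sphere and radial projection. -/

namespace GeoSphere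

theorem coe_neg {n : ℕ} (x : GeoSphere n) : (-x).1 = -x.1 := rfl

theorem dist_neg_self {n : ℕ} (x : GeoSphere n) : dist x (-x) = Real.pi := by
  rw [dist_def, coe_neg, inner_neg_right, real_inner_self_eq_norm_sq, x.2, one_pow,
    Real.arccos_neg_one]

theorem dist_le_pi {n : ℕ} (x y : GeoSphere n) : dist x y ≤ Real.pi := Real.arccos_le_pi _

theorem neg_neg_eq {n : ℕ} (x : GeoSphere n) : -(-x) = x := Subtype.ext (neg_neg x.1)

theorem ne_neg {n : ℕ} (x : GeoSphere n) : x ≠ -x := by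
  intro h
  have h1 := dist_neg_self x
  rw [← h, dist_self] at h1
  exact Real.pi_ne_zero h1.symm

/-- The `j`-th coordinate vector, as a point of the sphere. -/
noncomputable def basisPoint {n : ℕ} (j : Fin (n + 1)) : GeoSphere n :=
  ⟨EuclideanSpace.single j 1, by simp⟩

open Classical in
/-- The radial projection to the sphere, with an arbitrary value at the origin. -/
noncomputable def normalize {n : ℕ} (x : EuclideanSpace ℝ (Fin (n + 1))) : GeoSphere n :=
  if h : x = 0 then basisPoint 0
  else ⟨‖x‖⁻¹ • x, by rw [norm_smul, norm_inv, norm_norm, inv_mul_cancel₀ (norm_ne_zero_iff.mpr h)]⟩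

theorem coe_normalize {n : ℕ} {x : EuclideanSpace ℝ (Fin (n + 1))} (h : x ≠ 0) :
    (normalize x).1 = ‖x‖⁻¹ • x := by
  have h' : normalize x = ⟨‖x‖⁻¹ • x, by
      rw [norm_smul, norm_inv, norm_norm, inv_mul_cancel₀ (norm_ne_zero_iff.mpr h)]⟩ := dif_neg h
  rw [h']

theorem normalize_neg {n : ℕ} {x : EuclideanSpace ℝ (Fin (n + 1))} (h : x ≠ 0) :
    normalize (-x) = -normalize x := by
  refine Subtype.ext ?_
  rw [coe_neg, coe_normalize h, coe_normalize (neg_ne_zero.mpr h), norm_neg, smul_neg]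

theorem normalize_coe {n : ℕ} (x : GeoSphere n) : normalize x.1 = x := by
  have h : x.1 ≠ 0 := norm_ne_zero_iff.mp (by rw [x.2]; exact one_ne_zero)
  exact Subtype.ext (by rw [coe_normalize h, x.2, inv_one, one_smul])

/-- The topology of the target is that of the geodesic metric, so the angle to the limit point is
shown to tend to 0. -/
theorem continuousOn_normalize (n : ℕ) :
    ContinuousOn (normalize (n := n)) {x | x ≠ 0} := by
  intro x hx
  rw [ContinuousWithinAt, tendsto_iff_dist_tendsto_zero]
  have hx : x ≠ 0 := hx
  have h1 : ContinuousWithinAt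
      (fun y : EuclideanSpace ℝ (Fin (n + 1)) =>
        Real.arccos (inner ℝ (‖y‖⁻¹ • y) (‖x‖⁻¹ • x))) {x | x ≠ 0} x := by
    have h2 : ContinuousWithinAt (fun y : EuclideanSpace ℝ (Fin (n + 1)) => ‖y‖⁻¹ • y)
        {x | x ≠ 0} x :=
      ((continuous_norm.continuousAt.inv₀ (norm_ne_zero_iff.mpr hx)).smul
        continuousAt_id).continuousWithinAt
    exact Real.continuous_arccos.continuousAt.comp_continuousWithinAt
      (ContinuousWithinAt.inner (𝕜 := ℝ) h2 continuousWithinAt_const)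
  have h3 : Real.arccos (inner ℝ (‖x‖⁻¹ • x) (‖x‖⁻¹ • x)) = 0 := by
    rw [← coe_normalize hx, ← dist_def, dist_self]
  rw [ContinuousWithinAt, h3] at h1
  refine h1.congr' ?_
  filter_upwards [self_mem_nhdsWithin] with y hy
  rw [dist_def, coe_normalize hx, coe_normalize hy]

instance (n : ℕ) : CompactSpace (GeoSphere n) := by
  refine ⟨?_⟩
  have h : (Set.univ : Set (GeoSphere n)) = normalize '' Metric.sphere 0 1 := by
    exact (Set.eq_univ_of_forall fun x => (Set.mem_image _ _ _).mpr
      ⟨x.1, by simpa using x.2, normalize_coe x⟩).symm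
  rw [h]
  refine (isCompact_sphere _ _).image_of_continuousOn ((continuousOn_normalize n).mono ?_)
  rintro x hx rfl
  simp at hx

/-! ### Fine antipodal chains on the sphere. -/

section Chains

variable {k : ℕ}

/-- The standard basis of `ℝ^(k+1)`, extended by zero. -/
noncomputable def stdVec (k j : ℕ) : EuclideanSpace ℝ (Fin (k + 1)) :=
  if h : j < k + 1 then EuclideanSpace.single ⟨j, h⟩ 1 else 0

/-- The part of the unit ball on a supporting hyperplane of the cross-polytope. -/
def face (k : ℕ) (s : ℕ → ℝ) : Set (EuclideanSpace ℝ (Fin (k + 1))) :=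
  {x | ‖x‖ ≤ 1} ∩ {x | ∑ j : Fin (k + 1), s j * x j = 1}

theorem convex_face (s : ℕ → ℝ) : Convex ℝ (face k s) := by
  refine Convex.inter ?_ ?_
  · have h : {x : EuclideanSpace ℝ (Fin (k + 1)) | ‖x‖ ≤ 1} = Metric.closedBall 0 1 := by
      ext x
      simp
    rw [h]
    exact convex_closedBall _ _
  · refine convex_hyperplane (f := fun x : EuclideanSpace ℝ (Fin (k + 1)) =>
      ∑ j : Fin (k + 1), s j * x j) ⟨fun x y => ?_, fun c x => ?_⟩ 1
    · simp [mul_add, Finset.sum_add_distrib]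
    · simp only [PiLp.smul_apply, smul_eq_mul, Finset.mul_sum]
      exact Finset.sum_congr rfl fun j _ => by ring

theorem smul_stdVec_mem_face {s : ℕ → ℝ} (hs : ∀ j, s j = 1 ∨ s j = -1) {j : ℕ} (hj : j ≤ k) :
    s j • stdVec k j ∈ face k s := by
  have h1 : |s j| = 1 := by rcases hs j with h | h <;> simp [h]
  have h2 : s j * s j = 1 := by rcases hs j with h | h <;> simp [h]
  rw [stdVec, dif_pos (by omega)]
  constructor
  · simp [norm_smul, h1]
  · simp [h2]

/-- On a face, `1 = ∑ s j * x j ≤ (k + 1) ‖x‖`. This keeps subdivided chains uniformly away from the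
origin. -/
theorem le_norm_of_mem_face {s : ℕ → ℝ} (hs : ∀ j, s j = 1 ∨ s j = -1)
    {x : EuclideanSpace ℝ (Fin (k + 1))} (hx : x ∈ face k s) : ((k : ℝ) + 1)⁻¹ ≤ ‖x‖ := by
  have h1 : (1 : ℝ) ≤ ((k : ℝ) + 1) * ‖x‖ := by
    calc (1 : ℝ) = ∑ j : Fin (k + 1), s j * x j := hx.2.symm
      _ ≤ ∑ _j : Fin (k + 1), ‖x‖ := by
        refine Finset.sum_le_sum fun j _ => ?_
        have h := PiLp.norm_apply_le x j
        rw [Real.norm_eq_abs] at h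
        rcases hs j with h' | h' <;> rw [h']
        · linarith [le_abs_self (x j)]
        · linarith [neg_abs_le (x j)]
      _ = ((k : ℝ) + 1) * ‖x‖ := by simp
  rw [inv_le_iff_one_le_mul₀' (by positivity)]
  exact h1

/-- The sign vectors. -/
abbrev SignVec := {s : ℕ → ℝ // ∀ j, s j = 1 ∨ s j = -1}

open TupleChain in
theorem hemisphere_stdVec_mem {i : ℕ} (hi : i ≤ k) :
    hemisphere (stdVec k) i ∈ Finsupp.supported (ZMod 2) (ZMod 2)
      (⋃ s : SignVec, boundedTuples (face k s.1) (i + 1) 2) := by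
  refine Finsupp.supported_mono ?_ (hemisphere_mem (stdVec k) i)
  rintro σ ⟨h1, s, hs, h2⟩
  have h3 : ∀ x ∈ σ, x ∈ face k s := by
    intro x hx
    obtain ⟨j, hj, rfl⟩ := h2 x hx
    exact smul_stdVec_mem_face hs (hj.trans hi)
  refine Set.mem_iUnion.mpr ⟨⟨s, hs⟩, h1, h3, fun x hx y hy => ?_⟩
  have hx : ‖x‖ ≤ 1 := (h3 x hx).1
  have hy : ‖y‖ ≤ 1 := (h3 y hy).1
  linarith [dist_le_norm_add_norm x y]

open TupleChain

/-- Half of the `N`-fold barycentric subdivision of the boundary of the cross-polytope. -/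
noncomputable def fineChain (k N i : ℕ) : TupleChain (EuclideanSpace ℝ (Fin (k + 1))) :=
  (sd barycenter (i + 1))^[N] (hemisphere (stdVec k) i)

theorem fineChain_mem (N : ℕ) {i : ℕ} (hi : i ≤ k) :
    fineChain k N i ∈ Finsupp.supported (ZMod 2) (ZMod 2)
      (⋃ s : SignVec, boundedTuples (face k s.1) (i + 1) ((k / (k + 1)) ^ N * 2)) := by
  rw [fineChain]
  exact iterate_sd_mem (M := k) (D := 2) (n := i + 1) (A := fun s : SignVec => face k s.1)
    zero_le_two (Nat.succ_le_succ hi) (fun s => convex_face s.1) (hemisphere_stdVec_mem hi) N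

/-- The spherical shell containing the vertices of all `fineChain`s. -/
def shell (k : ℕ) : Set (EuclideanSpace ℝ (Fin (k + 1))) :=
  Metric.closedBall 0 1 ∩ {x | ((k : ℝ) + 1)⁻¹ ≤ ‖x‖}

theorem isCompact_shell (k : ℕ) : IsCompact (shell k) :=
  (isCompact_closedBall _ _).inter_right (isClosed_le continuous_const continuous_norm)

theorem ne_zero_of_mem_shell {x : EuclideanSpace ℝ (Fin (k + 1))} (hx : x ∈ shell k) : x ≠ 0 := by
  have hpos : (0 : ℝ) < ((k : ℝ) + 1)⁻¹ := by positivity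
  exact norm_pos_iff.mp (hpos.trans_le hx.2)

theorem mem_shell_of_mem_support {N i : ℕ} (hi : i ≤ k)
    {σ : List (EuclideanSpace ℝ (Fin (k + 1)))} (hσ : σ ∈ (fineChain k N i).support)
    {x : EuclideanSpace ℝ (Fin (k + 1))} (hx : x ∈ σ) : x ∈ shell k := by
  obtain ⟨s, -, h2, -⟩ := Set.mem_iUnion.mp (fineChain_mem N hi hσ)
  exact ⟨by simpa using (h2 x hx).1, le_norm_of_mem_face s.2 (h2 x hx)⟩

theorem bdry_fineChain_zero (k N : ℕ) : bdry (fineChain k N 0) = Finsupp.single [] 1 := by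
  rw [fineChain, bdry_iterate_sd, bdry_hemisphere_zero]
  exact Function.iterate_fixed (by simp only [sd, LinearMap.id_apply]) N

theorem bdry_fineChain_succ (k N i : ℕ) :
    bdry (fineChain k N (i + 1)) = fineChain k N i + map Neg.neg (fineChain k N i) := by
  rw [fineChain, bdry_iterate_sd, bdry_hemisphere_succ, iterate_map_add, fineChain,
    map_iterate_sd barycenter_map_neg]

/-- `normalize` is not odd at the origin, so the identity relies on all vertices lying in the shell.
-/
theorem map_normalize_map_neg (N : ℕ) {i : ℕ} (hi : i ≤ k) :
    map normalize (map Neg.neg (fineChain k N i)) =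
      map Neg.neg (map normalize (fineChain k N i)) := by
  simp only [TupleChain.map, Finsupp.lmapDomain_apply, ← Finsupp.mapDomain_comp]
  refine Finsupp.mapDomain_congr fun σ hσ => ?_
  simp only [Function.comp_apply, List.map_map]
  exact List.map_congr_left fun x hx =>
    normalize_neg (ne_zero_of_mem_shell (mem_shell_of_mem_support hi hσ hx))

/-- A form of the Lyusternik-Shnirelmann theorem: odd `ZMod 2`-valued functions `s 0, …, s (m-1)`
on a sphere of dimension at least `m` are all nonconstant on some arbitrarily small finite set. -/
theorem exists_small_list {m : ℕ} (hm : m ≤ k) {s : ℕ → GeoSphere k → ZMod 2}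
    (hs : ∀ j x, s j (-x) = s j x + 1) {U : GeoSphere k → Set (GeoSphere k)}
    (hU : ∀ p, IsOpen (U p)) (hpU : ∀ p, p ∈ U p) :
    ∃ p, ∃ σ : List (GeoSphere k), (∀ x ∈ σ, x ∈ U p) ∧
      ∀ j < m, ∃ x ∈ σ, ∃ y ∈ σ, s j x ≠ s j y := by
  -- The open cones over the sets `U p` cover the compact shell; once the mesh is below their
  -- Lebesgue number, each projected tuple lies in a single `U p`.
  obtain ⟨η, hη, hball⟩ := lebesgue_number_lemma_of_metric (isCompact_shell k)
    (c := fun p => {x | x ≠ 0} ∩ normalize ⁻¹' U p)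
    (fun p => (continuousOn_normalize k).isOpen_inter_preimage isOpen_ne (hU p))
    (fun x hx => Set.mem_iUnion.mpr ⟨normalize x, ne_zero_of_mem_shell hx, hpU _⟩)
  obtain ⟨N, hN⟩ : ∃ N : ℕ, ((k : ℝ) / (k + 1)) ^ N * 2 < η := by
    obtain ⟨N, hN⟩ := exists_pow_lt_of_lt_one (half_pos hη)
      (show (k : ℝ) / (k + 1) < 1 by rw [div_lt_one (by positivity)]; linarith)
    exact ⟨N, by linarith⟩
  have h1 := eval_cup_eq_one (ν := Neg.neg) hs (g := fun i => map normalize (fineChain k N i))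
    (m := m) (by rw [bdry_map, bdry_fineChain_zero, map_single, List.map_nil])
    (fun i hi => by
      rw [bdry_map, bdry_fineChain_succ, map_add, map_normalize_map_neg N (by omega)])
  obtain ⟨τ, hτ, hne⟩ := exists_mem_support_of_eval_ne_zero (h1.trans_ne one_ne_zero)
  classical
  obtain ⟨σ, hσ, rfl⟩ := Finset.mem_image.mp (Finsupp.mapDomain_support hτ)
  obtain ⟨-, hlen, -, hdist⟩ := Set.mem_iUnion.mp (fineChain_mem N hm hσ)
  obtain ⟨x, hx⟩ := List.exists_mem_of_length_pos (l := σ) (by omega)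
  obtain ⟨p, hp⟩ := hball x (mem_shell_of_mem_support hm hσ hx)
  refine ⟨p, σ.map normalize, fun y hy => ?_, fun j hj => exists_ne_of_cup_ne_zero hne hj⟩
  obtain ⟨z, hz, rfl⟩ := List.mem_map.mp hy
  exact (hp (Metric.mem_ball.mpr ((hdist z hz x hx).trans_lt hN))).2

end Chains

/-! ### Odd `ZMod 2`-valued functions adapted to a finite net. -/

/-- A well-ordering selects one point from each antipodal pair. -/
theorem exists_odd_zmod_two (n : ℕ) : ∃ s : GeoSphere n → ZMod 2, ∀ x, s (-x) = s x + 1 := by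
  classical
  refine ⟨fun x => if WellOrderingRel x (-x) then 0 else 1, fun x => ?_⟩
  have h1 : ¬ (WellOrderingRel x (-x) ∧ WellOrderingRel (-x) x) :=
    fun h => asymm h.1 h.2
  have h2 : WellOrderingRel x (-x) ∨ WellOrderingRel (-x) x := by
    rcases trichotomous_of WellOrderingRel x (-x) with h | h | h
    exacts [.inl h, absurd h (ne_neg x), .inr h]
  simp only [neg_neg_eq]
  by_cases h3 : WellOrderingRel x (-x) <;> by_cases h4 : WellOrderingRel (-x) x
  · tauto
  · simp [h3, h4]
  · simp [h3, h4]
    rfl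
  · tauto

/-- Finitely many odd functions suffice to have one that is constant on any given set without
almost antipodal points. -/
theorem exists_odd_family (n : ℕ) {δ : ℝ} (hδ : δ < Real.pi) :
    ∃ (m : ℕ) (s : ℕ → GeoSphere n → ZMod 2), (∀ j x, s j (-x) = s j x + 1) ∧
      ∀ T : Set (GeoSphere n), (∀ x ∈ T, ∀ y ∈ T, dist x y ≤ δ) →
        ∃ j < m, ∀ x ∈ T, s j x = 0 := by
  classical
  obtain ⟨s₀, hs₀⟩ := exists_odd_zmod_two n
  -- The `4 * η` pays for the four short steps of the path `z, p, y, w, q, -z` below, from a point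
  -- to its antipode.
  obtain ⟨η, hη, hηδ⟩ : ∃ η > 0, 4 * η + δ < Real.pi :=
    ⟨(Real.pi - δ) / 5, by linarith, by linarith⟩
  obtain ⟨P, -, hP, hcover⟩ :=
    (isCompact_univ (X := GeoSphere n)).finite_cover_balls hη
  let near : Set (GeoSphere n) → GeoSphere n → Prop := fun Q y => ∃ p ∈ Q, dist y p < η
  -- One odd function for each subset `Q` of the net: 0 near `Q`, 1 near `-Q`, and `s₀` elsewhere.
  -- If these prescriptions conflict, `s₀` is used everywhere.
  let t : Set (GeoSphere n) → GeoSphere n → ZMod 2 := fun Q y =>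
    if ∃ z, near Q z ∧ near Q (-z) then s₀ y
    else if near Q y then 0 else if near Q (-y) then 1 else s₀ y
  have ht : ∀ Q y, t Q (-y) = t Q y + 1 := by
    intro Q y
    by_cases h : ∃ z, near Q z ∧ near Q (-z)
    · simp only [t, if_pos h, hs₀]
    · have hy : ¬ (near Q y ∧ near Q (-y)) := fun h' => h ⟨y, h'⟩
      simp only [t, if_neg h, neg_neg_eq]
      by_cases h1 : near Q y <;> by_cases h2 : near Q (-y)
      · exact absurd ⟨h1, h2⟩ hy
      · simp [h1, h2]
      · simp [h1, h2]
        rfl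
      · simp [h1, h2, hs₀]
  have hfin : (𝒫 P).Finite := hP.powerset
  have := hfin.fintype
  let e := Fintype.equivFin (𝒫 P)
  refine ⟨Fintype.card (𝒫 P),
    fun j => if h : j < Fintype.card (𝒫 P) then t (e.symm ⟨j, h⟩).1 else s₀, ?_, ?_⟩
  · intro j x
    by_cases h : j < Fintype.card (𝒫 P)
    · simp only [dif_pos h, ht]
    · simp only [dif_neg h, hs₀]
  · intro T hT
    -- The net points close to `T`; every point of `T` is near this `Q`.
    let Q : 𝒫 P := ⟨{p ∈ P | ∃ y ∈ T, dist y p < η}, fun p hp => hp.1⟩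
    refine ⟨e Q, (e Q).2, fun x hx => ?_⟩
    have hgood : ¬ ∃ z, near Q.1 z ∧ near Q.1 (-z) := by
      rintro ⟨z, ⟨p, ⟨-, y, hy, hyp⟩, hzp⟩, q, ⟨-, w, hw, hwq⟩, hzq⟩
      have h1 := hT y hy w hw
      have h2 := dist_neg_self z
      have h3 := dist_triangle4 z p y w
      have h4 := dist_triangle4 z w q (-z)
      rw [dist_comm] at hyp hzq
      linarith
    have hnear : near Q.1 x := by
      obtain ⟨p, hp, hxp⟩ := Set.mem_iUnion₂.mp (hcover (Set.mem_univ x))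
      exact ⟨p, ⟨hp, x, hx, hxp⟩, hxp⟩
    simp only [Fin.is_lt, dif_pos, Fin.eta, Equiv.symm_apply_apply]
    simp only [t, if_neg hgood, if_pos hnear]

/-- The great circle through the first two coordinate vectors. -/
noncomputable def circlePoint (k : ℕ) (t : ℝ) : GeoSphere (k + 1) :=
  ⟨Real.cos t • EuclideanSpace.single 0 1 + Real.sin t • EuclideanSpace.single 1 1, by
    rw [← sq_eq_sq₀ (norm_nonneg _) zero_le_one, norm_add_sq_real]
    simp [norm_smul, inner_smul_left, inner_smul_right, EuclideanSpace.inner_single_left]⟩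

theorem dist_circlePoint (k : ℕ) {t : ℝ} (h0 : |t| ≤ Real.pi) :
    dist (circlePoint k t) (circlePoint k 0) = |t| := by
  rw [dist_def, ← Real.arccos_cos (abs_nonneg t) h0, Real.cos_abs]
  simp [circlePoint, inner_add_left, inner_smul_left, EuclideanSpace.inner_single_left]

theorem circlePoint_apply_one (k : ℕ) (t : ℝ) : (circlePoint k t).1 1 = Real.sin t := by
  simp [circlePoint]

end GeoSphere

/-! ### Modulus of discontinuity and distortion. -/

section Invariants

open GeoSphere

theorem exists_isOpen_dist_le_of_modulusOfDiscontinuity_lt {X Y : Type*} [TopologicalSpace X]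
    [MetricSpace Y] [BoundedSpace Y] {f : X → Y} {δ : ℝ} (h : modulusOfDiscontinuity f < δ) (x : X) :
    ∃ U : Set X, IsOpen U ∧ x ∈ U ∧ ∀ y ∈ U, ∀ z ∈ U, dist (f y) (f z) ≤ δ := by
  -- Since `sInf ∅ = 0`, nonemptiness must be checked; the diameter of the bounded space `Y` is
  -- admissible.
  have hne : {δ : ℝ | 0 ≤ δ ∧ ∀ x : X, ∃ U : Set X, IsOpen U ∧ x ∈ U ∧
      Metric.diam (f '' U) ≤ δ}.Nonempty :=
    ⟨Metric.diam (Set.univ : Set Y), Metric.diam_nonneg, fun x => ⟨Set.univ, isOpen_univ, trivial,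
      Metric.diam_mono (Set.subset_univ _) (Bornology.IsBounded.all _)⟩⟩
  obtain ⟨δ', hδ', hlt⟩ := exists_lt_of_csInf_lt hne h
  obtain ⟨U, hU, hx, hd⟩ := hδ'.2 x
  exact ⟨U, hU, hx, fun y hy z hz => (Metric.dist_le_diam_of_mem (Bornology.IsBounded.all _)
    (Set.mem_image_of_mem f hy) (Set.mem_image_of_mem f hz)).trans (hd.trans hlt.le)⟩

theorem abs_dist_sub_dist_le_pi {k n : ℕ} (f : GeoSphere k → GeoSphere n) (x y : GeoSphere k) :
    |dist x y - dist (f x) (f y)| ≤ Real.pi := by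
  rw [abs_le]
  constructor <;> linarith [dist_le_pi x y, dist_le_pi (f x) (f y), dist_nonneg (x := x) (y := y),
    dist_nonneg (x := f x) (y := f y)]

theorem distortion_le_pi {k n : ℕ} (f : GeoSphere k → GeoSphere n) : distortion f ≤ Real.pi := by
  refine csSup_le ⟨_, basisPoint 0, basisPoint 0, rfl⟩ ?_
  rintro _ ⟨x, y, rfl⟩
  exact abs_dist_sub_dist_le_pi f x y

/-- Points of a ball of radius `η / 2` are less than `η` apart, so their images are within `dis(f) +
η`. -/
theorem modulusOfDiscontinuity_le_distortion {k n : ℕ} (f : GeoSphere k → GeoSphere n) :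
    modulusOfDiscontinuity f ≤ distortion f := by
  have hdis : ∀ x y, |dist x y - dist (f x) (f y)| ≤ distortion f := fun x y =>
    le_csSup ⟨Real.pi, by rintro _ ⟨x, y, rfl⟩; exact abs_dist_sub_dist_le_pi f x y⟩ ⟨x, y, rfl⟩
  have h0 : 0 ≤ distortion f := (abs_nonneg _).trans (hdis (basisPoint 0) (basisPoint 0))
  refine le_of_forall_pos_le_add fun η hη => ?_
  refine csInf_le ⟨0, fun _ h => h.1⟩ ⟨by positivity, fun x => ⟨Metric.ball x (η / 2),
    Metric.isOpen_ball, Metric.mem_ball_self (half_pos hη),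
    Metric.diam_le_of_forall_dist_le (by positivity) ?_⟩⟩
  rintro _ ⟨y, hy, rfl⟩ _ ⟨z, hz, rfl⟩
  have h1 := neg_le_of_abs_le (hdis y z)
  have h2 := dist_triangle_right y z x
  rw [Metric.mem_ball] at hy hz
  linarith

theorem exists_lt_modulusOfDiscontinuity (n : ℕ) {ε : ℝ} (hε : 0 < ε) :
    ∃ K : ℕ, ∀ k : ℕ, K ≤ k → ∀ f : GeoSphere k → GeoSphere n, Function.Odd f →
      Real.pi - ε < modulusOfDiscontinuity f := by
  -- The bound `ε / 2` leaves strict room above the modulus. The resulting `m` does not depend on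
  -- `k` or `f`, which gives uniformity.
  obtain ⟨m, s, hs, hT⟩ := exists_odd_family n (δ := Real.pi - ε / 2) (by linarith)
  refine ⟨m, fun k hk f hf => ?_⟩
  by_contra! hle
  choose U hU hpU hdist using
    exists_isOpen_dist_le_of_modulusOfDiscontinuity_lt (hle.trans_lt
      (show Real.pi - ε < Real.pi - ε / 2 by linarith))
  obtain ⟨p, σ, hσ, hne⟩ := exists_small_list hk (s := fun j x => s j (f x))
    (fun j x => by rw [hf, hs]) hU hpU
  obtain ⟨j, hj, hconst⟩ := hT (f '' {x | x ∈ σ}) (by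
    rintro _ ⟨x, hx, rfl⟩ _ ⟨y, hy, rfl⟩
    exact hdist p x (hσ x hx) y (hσ y hy))
  obtain ⟨x, hx, y, hy, hxy⟩ := hne j hj
  exact hxy ((hconst _ ⟨x, hx, rfl⟩).trans (hconst _ ⟨y, hy, rfl⟩).symm)

theorem exists_odd_pi_le_modulusOfDiscontinuity (k n : ℕ) (hk : 1 ≤ k) :
    ∃ f : GeoSphere k → GeoSphere n, Function.Odd f ∧ Real.pi ≤ modulusOfDiscontinuity f := by
  classical
  obtain ⟨k, rfl⟩ : ∃ k', k = k' + 1 := ⟨k - 1, by omega⟩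
  obtain ⟨s, hs⟩ := exists_odd_zmod_two (k + 1)
  let v : GeoSphere n := basisPoint 0
  have hs' : ∀ a : ZMod 2, a + 1 = 0 ↔ a ≠ 0 := by decide
  -- The sign of one coordinate decides between `v` and `-v`; on its zero set the odd function `s`
  -- keeps the map odd.
  refine ⟨fun x => if 0 < x.1 1 ∨ (x.1 1 = 0 ∧ s x = 0) then v else -v, fun x => ?_, ?_⟩
  · have h1 : (-x).1 1 = -x.1 1 := rfl
    simp only [h1, hs, hs', neg_pos, neg_eq_zero]
    rcases lt_trichotomy (x.1 1) 0 with h | h | h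
    · simp [h, h.not_gt, h.ne, neg_neg_eq]
    · by_cases h2 : s x = 0 <;> simp [h, h2, neg_neg_eq]
    · simp [h, h.not_gt, h.ne']
  · by_contra! hlt
    obtain ⟨δ, h1, h2⟩ := exists_between hlt
    obtain ⟨U, hU, hx, hd⟩ :=
      exists_isOpen_dist_le_of_modulusOfDiscontinuity_lt h1 (circlePoint k 0)
    obtain ⟨r, hr, hball⟩ := Metric.isOpen_iff.mp hU _ hx
    obtain ⟨t, ht0, ht⟩ := exists_between (lt_min hr Real.pi_pos)
    have htr := ht.trans_le (min_le_left _ _)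
    have htp := ht.trans_le (min_le_right _ _)
    have hsin := Real.sin_pos_of_pos_of_lt_pi ht0 htp
    -- The points at angles `t` and `-t` lie on opposite sides of the equator, arbitrarily close to
    -- `circlePoint k 0`, and have antipodal images.
    have hd' := hd (circlePoint k t) (hball (by
        rw [Metric.mem_ball, dist_circlePoint k (by rw [abs_of_pos ht0]; exact htp.le),
          abs_of_pos ht0]
        exact htr)) (circlePoint k (-t)) (hball (by
        rw [Metric.mem_ball, dist_circlePoint k (by rw [abs_neg, abs_of_pos ht0]; exact htp.le),
          abs_neg, abs_of_pos ht0]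
        exact htr))
    simp only [circlePoint_apply_one, Real.sin_neg, neg_pos, neg_eq_zero, hsin, hsin.not_gt,
      hsin.ne', if_true, false_and, or_false, if_false, dist_neg_self] at hd'
    linarith

end Invariants

theorem mainTheorem7 (n : ℕ) (hn : 1 ≤ n) :
    (∀ k : ℕ, 1 ≤ k →
      IsGreatest {t : ℝ | ∃ f : GeoSphere k → GeoSphere n,
        Function.Odd f ∧ t = modulusOfDiscontinuity f} Real.pi ∧
      IsGreatest {t : ℝ | ∃ f : GeoSphere k → GeoSphere n,
        Function.Odd f ∧ t = distortion f} Real.pi) ∧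
    (∀ ε : ℝ, 0 < ε → ∃ K : ℕ, ∀ k : ℕ, K ≤ k →
      ∀ f : GeoSphere k → GeoSphere n, Function.Odd f →
        (Real.pi - ε < modulusOfDiscontinuity f ∧ modulusOfDiscontinuity f ≤ Real.pi) ∧
        (Real.pi - ε < distortion f ∧ distortion f ≤ Real.pi)) := by
  have hle : ∀ (k : ℕ) (f : GeoSphere k → GeoSphere n), modulusOfDiscontinuity f ≤ Real.pi :=
    fun k f => (modulusOfDiscontinuity_le_distortion f).trans (distortion_le_pi f)
  refine ⟨fun k hk => ?_, fun ε hε => ?_⟩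
  · obtain ⟨f, hf, hfπ⟩ := exists_odd_pi_le_modulusOfDiscontinuity k n hk
    refine ⟨⟨⟨f, hf, hfπ.antisymm (hle k f)⟩, ?_⟩, ⟨f, hf, ?_⟩, ?_⟩
    · rintro _ ⟨g, -, rfl⟩
      exact hle k g
    · exact (hfπ.trans (modulusOfDiscontinuity_le_distortion f)).antisymm (distortion_le_pi f)
    · rintro _ ⟨g, -, rfl⟩
      exact distortion_le_pi g
  · obtain ⟨K, hK⟩ := exists_lt_modulusOfDiscontinuity n hε
    refine ⟨K, fun k hk f hf => ⟨⟨hK k hk f hf, hle k f⟩, ?_, distortion_le_pi f⟩⟩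
    exact (hK k hk f hf).trans_le (modulusOfDiscontinuity_le_distortion f)
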